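/- Let $A,F\in\mathbb{R}^{n\times n}$ be generic, i.e. the nonzero entries of $A$ and $F$ together are algebraically independent over $\mathbb{Q}$, and assume that the descriptor system $F\dot x=Ax+Bu$ is solvable, i.e. $\operatorname{rank}(A-sF)=n$ with $s$ an indeterminate. The system is called structurally controllable if the nonzero entries of $A$, $F$, $B$ together are algebraically independent over $\mathbb{Q}$ and $\operatorname{rank}[A-zF\mid B]=n$ for every $z\in\mathbb{C}$. Let $V^-=\{e_1,\dots,e_n\}$ be the set of equation nodes (rows) and $X=\{x_1,\dots,x_n\}$ the set of variable nodes (columns). A set $S\subseteq V^-$ is an input configuration if there is $b\in\mathbb{R}^n$ with $\{e_i\mid b_i\neq 0\}=S$ such that the system with $B=\operatorname{diag}(b)$ is structurally controllable. Let $G_A$ and $G_{A-sF}$ be the bipartite graphs on $V^-$ and $X$ with edge sets $E_A=\{(e_i,x_j)\mid A_{ij}\neq0\}$ and $E_A\cup E_F$, where $E_F=\{(e_i,x_j)\mid F_{ij}\neq0\}$ is the set of s-arcs. Take a maximum matching $N$ of $G_{A-sF}$ and the directed graph $\tilde G_N$ in which every edge of $G_{A-sF}$ is directed from $X$ to $V^-$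 and the edges of $N$ can also be traversed from $V^-$ to $X$. Remove the nodes reachable from an $N$-unmatched node of $X$ and the nodes from which an $N$-unmatched node of $V^-$ can be reached; the strongly connected components of what remains are the consistent DM components (by solvability nothing is in fact removed). Their order is: $G_i\preceq G_j$ if and only if $\tilde G_N$ has a directed path from $G_j$ to $G_i$. A consistent component is an s-component if its induced subgraph contains an s-arc, and it is a maximal s-component if no other consistent s-component is greater. For $c \in V^-$, $[c]$ denotes the DM component of $G_{A-sF}$ containing $c$. Theorem. For every choice of $N$, a set $S\subseteq V^-$ is an input configuration if and only if there are a maximum matching $M$ of $G_A$ and a set $C\subseteq V^-$ such that $$S\supseteq U_M\cup C,$$ where $U_M\subseteq V^-$ is the set of equation nodes not covered by $M$, and $C$ reaches all maximal s-components, i.e. for every maximal s-component $G_i$ there is $c\in C$ with $G_i\preceq [c]$. -/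

import Mathlib

noncomputable section

/-! ### Generic descriptor systems `F ẋ = A x + B u` -/

/-- A real matrix is generic if its nonzero entries are algebraically independent over `ℚ`. -/
def IsGeneric {m k : Type*} (N : Matrix m k ℝ) : Prop :=
  AlgebraicIndependent ℚ (fun p : {p : m × k // N p.1 p.2 ≠ 0} => N p.1.1 p.1.2)

/-- Solvability of `F ẋ = A x + B u`: `rank (A - s F) = n` with `s` an indeterminate, the rank
being taken over the field of rational functions in `s`. -/
def IsSolvableSystem {n : ℕ} (A F : Matrix (Fin n) (Fin n) ℝ) : Prop :=
  (A.map (algebraMap ℝ (RatFunc ℝ))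
    - (RatFunc.X : RatFunc ℝ) • F.map (algebraMap ℝ (RatFunc ℝ))).rank = n

/-- Structural controllability of `F ẋ = A x + B u`: the matrices `A`, `F`, `B` are generic
(jointly: all their nonzero entries together are independent parameters), and
`rank [A - z F | B] = n` for every complex number `z`. -/
def IsStructurallyControllable {n : ℕ} {k : Type*} [Fintype k]
    (A F : Matrix (Fin n) (Fin n) ℝ) (B : Matrix (Fin n) k ℝ) : Prop :=
  IsGeneric (Matrix.fromCols A (Matrix.fromCols F B)) ∧
    ∀ z : ℂ, (Matrix.fromCols (A.map (algebraMap ℝ ℂ) - z • F.map (algebraMap ℝ ℂ))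
      (B.map (algebraMap ℝ ℂ))).rank = n

/-- A set `S` of equation nodes (row indices) is an input configuration if connecting inputs
exactly to the nodes of `S`, each input to a single node, makes the system structurally
controllable: `B = diag(b)` with `b` of support `S`. -/
def IsInputConfiguration {n : ℕ} (A F : Matrix (Fin n) (Fin n) ℝ) (S : Set (Fin n)) : Prop :=
  ∃ b : Fin n → ℝ, {i | b i ≠ 0} = S ∧ IsStructurallyControllable A F (Matrix.diagonal b)

/-! ### Bipartite graphs

The edge set of a bipartite graph is a set of pairs `(l, r)` with `l` in the left node set `L`
(this is `V⁻`) and `r` in the right node set `R` (this is `V⁺`). -/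

/-- The edges given by the nonzero entries of a matrix: left nodes are the rows (equations), right
nodes are the columns (variables). -/
def matrixEdges {n : ℕ} (N : Matrix (Fin n) (Fin n) ℝ) : Set (Fin n × Fin n) :=
  {p | N p.1 p.2 ≠ 0}

section Bipartite

variable {L R : Type*}

/-- A matching of the bipartite graph `E`: a set of edges no two of which share an end. -/
def IsMatching (E : Set (L × R)) (M : Finset (L × R)) : Prop :=
  (M : Set (L × R)) ⊆ E ∧ Set.InjOn Prod.fst (M : Set (L × R)) ∧
    Set.InjOn Prod.snd (M : Set (L × R))

/-- A matching with the largest possible number of edges. -/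
def IsMaximumMatching (E : Set (L × R)) (M : Finset (L × R)) : Prop :=
  IsMatching E M ∧ ∀ M' : Finset (L × R), IsMatching E M' → M'.card ≤ M.card

/-- The left nodes that are not covered by `M`. -/
def leftUnmatched (M : Finset (L × R)) : Set L := {l | ∀ e ∈ M, e.1 ≠ l}

/-- The right nodes that are not covered by `M`. -/
def rightUnmatched (M : Finset (L × R)) : Set R := {r | ∀ e ∈ M, e.2 ≠ r}

/-! ### Dulmage–Mendelsohn decomposition -/

/-- Arcs of the auxiliary directed graph: every edge is directed from its right node to its left
node, and the edges of `M` can also be traversed from left to right. -/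
inductive AuxArc (E : Set (L × R)) (M : Finset (L × R)) : L ⊕ R → L ⊕ R → Prop
  | edge {l : L} {r : R} : (l, r) ∈ E → AuxArc E M (Sum.inr r) (Sum.inl l)
  | matched {l : L} {r : R} : (l, r) ∈ M → AuxArc E M (Sum.inl l) (Sum.inr r)

/-- Existence of a directed path (possibly of length zero) in the auxiliary graph. -/
def AuxReach (E : Set (L × R)) (M : Finset (L × R)) : L ⊕ R → L ⊕ R → Prop :=
  Relation.ReflTransGen (AuxArc E M)

/-- `V₀`: the nodes that can be reached from an unmatched right node. -/
def dmZero (E : Set (L × R)) (M : Finset (L × R)) : Set (L ⊕ R) :=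
  {v | ∃ r ∈ rightUnmatched M, AuxReach E M (Sum.inr r) v}

/-- `V_∞`: the nodes from which an unmatched left node can be reached. -/
def dmInfty (E : Set (L × R)) (M : Finset (L × R)) : Set (L ⊕ R) :=
  {v | ∃ l ∈ leftUnmatched M, AuxReach E M v (Sum.inl l)}

/-- The nodes outside the inconsistent components. -/
def dmConsistentNodes (E : Set (L × R)) (M : Finset (L × R)) : Set (L ⊕ R) :=
  (dmZero E M ∪ dmInfty E M)ᶜ

/-- Existence of a directed path in the auxiliary graph with `V₀ ∪ V_∞` removed. -/
def ConsistentReach (E : Set (L × R)) (M : Finset (L × R)) : L ⊕ R → L ⊕ R → Prop :=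
  Relation.ReflTransGen fun v w =>
    v ∈ dmConsistentNodes E M ∧ w ∈ dmConsistentNodes E M ∧ AuxArc E M v w

/-- The consistent DM components (given by their node sets): the strongly connected components of
the auxiliary graph with `V₀ ∪ V_∞` removed. -/
def IsConsistentComponent (E : Set (L × R)) (M : Finset (L × R)) (K : Set (L ⊕ R)) : Prop :=
  ∃ v ∈ dmConsistentNodes E M, K = {w | ConsistentReach E M v w ∧ ConsistentReach E M w v}

/-- The DM order `K₁ ⪯ K₂` on consistent components: the auxiliary graph has a directed path from
`K₂` to `K₁`. -/
def DMLe (E : Set (L × R)) (M : Finset (L × R)) (K₁ K₂ : Set (L ⊕ R)) : Prop :=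
  ∃ v ∈ K₂, ∃ w ∈ K₁, AuxReach E M v w

/-- A consistent DM component is an s-component if the subgraph induced on it has an edge in the
set `Es` of s-arcs. -/
def IsSComponent (E Es : Set (L × R)) (M : Finset (L × R)) (K : Set (L ⊕ R)) : Prop :=
  IsConsistentComponent E M K ∧ ∃ p ∈ Es, Sum.inl p.1 ∈ K ∧ Sum.inr p.2 ∈ K

/-- A maximal consistent s-component: no other consistent s-component is greater. -/
def IsMaximalSComponent (E Es : Set (L × R)) (M : Finset (L × R)) (K : Set (L ⊕ R)) : Prop :=
  IsSComponent E Es M K ∧ ∀ K', IsSComponent E Es M K' → DMLe E M K K' → K' = K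

/-- The set `C` of left nodes reaches every maximal consistent s-component `K`: there is `c ∈ C`
whose DM component `[c]` satisfies `K ⪯ [c]`. -/
def ReachesMaximalSComponents (E Es : Set (L × R)) (M : Finset (L × R)) (C : Set L) : Prop :=
  ∀ K, IsMaximalSComponent E Es M K →
    ∃ c ∈ C, ∃ Kc, IsConsistentComponent E M Kc ∧ Sum.inl c ∈ Kc ∧ DMLe E M K Kc

end Bipartite

end

noncomputable section

/-! ### Specialization of generic matrices -/

/-! The rank condition at `z` says that no nonzero left kernel vector of `A - zF` vanishes on `S`
(`rank_fromCols_diagonal_iff`). Solvability makes `N` perfect. Permuting columns along `N` gives the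
pencil a nonzero diagonal and turns the auxiliary graph into a digraph on rows, with an arc from `j`
to `i` for each nonzero entry `(i, j)`. Since every s-component lies below a maximal one, the
condition on `C` says that every entry of `F` lying on a cycle is reached from `C`
(`reachesMaximalSComponents_iff_pencilReach`).

At `z = 0` the condition is independence of the rows of `A` outside `S`. Generic rank equals
matching number, so such rows extend to a row basis, and a transversal of that basis is a maximum
matching.

At `z ≠ 0`, sufficiency rests on the fact that adjoining `z` to the scalars destroys the
independence of at most one entry (`exists_subsingleton_compl`). On the rows reached from `S`,
Hall's theorem gives a transversal avoiding the column of that entry, so kernel vectors vanish there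
(`vanishes_of_reached`). On the other rows no entry of `F` lies on a cycle, so their principal minor
does not depend on `z` and equals its nonzero value at `0`.

Necessity: for a cyclic entry of `F` in a row `e` not reached from `S`, the rows that reach `e` form
a block whose determinant is nonconstant in `z`. A complex root gives a forbidden kernel vector
(`exists_reaching_of_kernelTrivialOff`). -/

/-- A polynomial relation between parameters that are algebraically independent on a set `Q` and
zero outside of `Q` persists under every specialization of the parameters in `Q`. -/
theorem eval_eq_zero_of_aeval_eq_zero {k K P : Type*} [CommRing k] [CommRing K] [Algebra k K]
    {Q : Set P} {x : P → K} (hx : AlgebraicIndependent k (fun q : Q => x q))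
    (hx0 : ∀ p ∉ Q, x p = 0) {y : P → k} (hy0 : ∀ p ∉ Q, y p = 0)
    {g : MvPolynomial P k} (hg : MvPolynomial.aeval x g = 0) : MvPolynomial.eval y g = 0 := by
  classical
  -- Setting the variables outside `Q` to zero changes neither evaluation, and independence then
  -- kills the remaining polynomial itself.
  let f : MvPolynomial P k →ₐ[k] MvPolynomial Q k :=
    MvPolynomial.aeval fun p => if h : p ∈ Q then MvPolynomial.X ⟨p, h⟩ else 0
  have hfx : (MvPolynomial.aeval fun q : Q => x q).comp f = MvPolynomial.aeval x := by
    ext p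
    by_cases h : p ∈ Q <;> simp [f, h, hx0]
  have hfy : (MvPolynomial.aeval fun q : Q => y q).comp f = MvPolynomial.aeval y := by
    ext p
    by_cases h : p ∈ Q <;> simp [f, h, hy0]
  have h0 : f g = 0 := hx.eq_zero_of_aeval_eq_zero _ (by rw [← hg, ← hfx]; rfl)
  have h1 : MvPolynomial.aeval y g = 0 := by rw [← hfy, AlgHom.comp_apply, h0, map_zero]
  simpa [MvPolynomial.aeval_def] using h1

section Pencil

variable {ι κ k K : Type*} [CommRing k]

/-- The square submatrix of `A - z F` with rows `r` and columns `c`, where the entries of `A` and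
`F` are given by one family of parameters. -/
def pencilMinor (x : ι × (ι ⊕ ι) → k) (z : k) (r c : κ → ι) : Matrix κ κ k :=
  Matrix.of fun i j => x (r i, Sum.inl (c j)) - z * x (r i, Sum.inr (c j))

open Classical in
/-- The entries that realize one chosen arc `(r i, c i)` per row; it is taken from the second
matrix exactly if `s i` holds. -/
def transversalEntries (r c : κ → ι) (s : κ → Prop) : ι × (ι ⊕ ι) → k :=
  fun p => if ∃ i, p = (r i, if s i then Sum.inr (c i) else Sum.inl (c i)) then 1 else 0

open Classical in
theorem transversalEntries_inl {r c : κ → ι} (hr : r.Injective) (hc : c.Injective)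
    (s : κ → Prop) (i j : κ) :
    transversalEntries (k := k) r c s (r i, Sum.inl (c j)) = if i = j ∧ ¬ s i then 1 else 0 := by
  refine if_congr ⟨?_, ?_⟩ rfl rfl
  · rintro ⟨a, ha⟩
    rw [Prod.mk.injEq] at ha
    obtain rfl := hr ha.1
    by_cases hs : s i
    · simp [hs] at ha
    · simpa [hs, hc.eq_iff, eq_comm] using ha
  · rintro ⟨rfl, hs⟩
    exact ⟨i, by simp [hs]⟩

open Classical in
theorem transversalEntries_inr {r c : κ → ι} (hr : r.Injective) (hc : c.Injective)
    (s : κ → Prop) (i j : κ) :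
    transversalEntries (k := k) r c s (r i, Sum.inr (c j)) = if i = j ∧ s i then 1 else 0 := by
  refine if_congr ⟨?_, ?_⟩ rfl rfl
  · rintro ⟨a, ha⟩
    rw [Prod.mk.injEq] at ha
    obtain rfl := hr ha.1
    by_cases hs : s i
    · simpa [hs, hc.eq_iff, eq_comm] using ha
    · simp [hs] at ha
  · rintro ⟨rfl, hs⟩
    exact ⟨i, by simp [hs]⟩

theorem transversalEntries_eq_zero {Q : Set (ι × (ι ⊕ ι))} {r c : κ → ι} {s : κ → Prop}
    (h1 : ∀ i, s i → (r i, Sum.inr (c i)) ∈ Q) (h2 : ∀ i, ¬ s i → (r i, Sum.inl (c i)) ∈ Q)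
    (p) (hp : p ∉ Q) : transversalEntries (k := k) r c s p = 0 := by
  unfold transversalEntries
  rw [if_neg]
  rintro ⟨i, rfl⟩
  by_cases hs : s i
  · exact hp (by simpa [hs] using h1 i hs)
  · exact hp (by simpa [hs] using h2 i hs)

variable [Fintype κ] [DecidableEq κ]

theorem map_det_pencilMinor [CommRing K] (f : k →+* K) (x : ι × (ι ⊕ ι) → k) (z : k)
    (r c : κ → ι) : f (pencilMinor x z r c).det = (pencilMinor (f ∘ x) (f z) r c).det := by
  rw [RingHom.map_det]
  congr 1
  ext i j
  simp [pencilMinor]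

/-- The determinant of a minor of `A - z F`, as a polynomial in the entries. -/
def pencilPolynomial (k : Type*) [CommRing k] (z : k) (r c : κ → ι) :
    MvPolynomial (ι × (ι ⊕ ι)) k :=
  (pencilMinor MvPolynomial.X (MvPolynomial.C z) r c).det

theorem eval_pencilPolynomial (y : ι × (ι ⊕ ι) → k) (z : k) (r c : κ → ι) :
    MvPolynomial.eval y (pencilPolynomial k z r c) = (pencilMinor y z r c).det := by
  rw [pencilPolynomial, map_det_pencilMinor]
  congr 2
  · ext p; simp
  · simp

theorem aeval_pencilPolynomial [CommRing K] [Algebra k K] (x : ι × (ι ⊕ ι) → K) (z : k)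
    (r c : κ → ι) :
    MvPolynomial.aeval x (pencilPolynomial k z r c)
      = (pencilMinor x (algebraMap k K z) r c).det := by
  rw [pencilPolynomial, ← AlgHom.coe_toRingHom, map_det_pencilMinor]
  congr 2
  · ext p; simp
  · simp

open Classical in
theorem det_pencilMinor_transversalEntries {r c : κ → ι} (hr : r.Injective) (hc : c.Injective)
    (s : κ → Prop) (z : k) :
    (pencilMinor (transversalEntries r c s) z r c).det = ∏ i, if s i then -z else 1 := by
  rw [← Matrix.det_diagonal]
  congr 1
  ext i j
  rw [pencilMinor, Matrix.of_apply, transversalEntries_inl hr hc, transversalEntries_inr hr hc,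
    Matrix.diagonal_apply]
  by_cases hij : i = j
  · subst hij
    by_cases hs : s i <;> simp [hs]
  · simp [hij]

/-- A generic minor of `A - z F` with a transversal of nonzero entries is nonsingular. -/
theorem det_pencilMinor_ne_zero [IsDomain k] [CommRing K] [Algebra k K]
    {Q : Set (ι × (ι ⊕ ι))} {x : ι × (ι ⊕ ι) → K}
    (hx : AlgebraicIndependent k (fun q : Q => x q)) (hx0 : ∀ p ∉ Q, x p = 0)
    {r c : κ → ι} (hr : r.Injective) (hc : c.Injective) (z : k)
    (h : ∀ i, (r i, Sum.inl (c i)) ∈ Q ∨ (r i, Sum.inr (c i)) ∈ Q ∧ z ≠ 0) :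
    (pencilMinor x (algebraMap k K z) r c).det ≠ 0 := by
  classical
  intro h0
  rw [← aeval_pencilPolynomial] at h0
  have h1 := eval_eq_zero_of_aeval_eq_zero hx hx0
    (y := transversalEntries r c fun i => (r i, Sum.inl (c i)) ∉ Q)
    (transversalEntries_eq_zero (fun i hi => ((h i).resolve_left hi).1) (fun i hi => not_not.1 hi))
    h0
  rw [eval_pencilPolynomial, det_pencilMinor_transversalEntries hr hc,
    Finset.prod_eq_zero_iff] at h1
  obtain ⟨i, -, hi⟩ := h1
  by_cases hs : (r i, Sum.inl (c i)) ∈ Q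
  · simp [hs] at hi
  · exact ((h i).resolve_left hs).2 (by simpa [hs] using hi)

/-- A generic minor of `A - z F` with a transversal of nonzero entries of which one belongs to `F`
depends on `z`. -/
theorem det_pencilMinor_one_ne_zero [IsDomain k] [CommRing K] [Algebra k K]
    {Q : Set (ι × (ι ⊕ ι))} {x : ι × (ι ⊕ ι) → K}
    (hx : AlgebraicIndependent k (fun q : Q => x q)) (hx0 : ∀ p ∉ Q, x p = 0)
    {r c : κ → ι} (hr : r.Injective) (hc : c.Injective)
    (h : ∀ i, (r i, Sum.inl (c i)) ∈ Q ∨ (r i, Sum.inr (c i)) ∈ Q)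
    {i₀ : κ} (hi₀ : (r i₀, Sum.inr (c i₀)) ∈ Q) :
    (pencilMinor x 1 r c).det ≠ (pencilMinor x 0 r c).det := by
  classical
  obtain ⟨s, hs⟩ : ∃ s : κ → Prop, ∀ i, s i ↔ i = i₀ ∨ (r i, Sum.inl (c i)) ∉ Q :=
    ⟨_, fun _ => Iff.rfl⟩
  intro h0
  rw [← map_one (algebraMap k K), ← map_zero (algebraMap k K), ← aeval_pencilPolynomial,
    ← aeval_pencilPolynomial, ← sub_eq_zero, ← map_sub] at h0
  have h1 := eval_eq_zero_of_aeval_eq_zero hx hx0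
    (y := transversalEntries r c s)
    (transversalEntries_eq_zero
      (fun i hi => ((hs i).1 hi).elim (fun e => e ▸ hi₀) fun hi => (h i).resolve_left hi)
      (fun i hi => not_not.1 fun hi' => hi ((hs i).2 (Or.inr hi')))) h0
  rw [map_sub, eval_pencilPolynomial, eval_pencilPolynomial,
    det_pencilMinor_transversalEntries hr hc, det_pencilMinor_transversalEntries hr hc,
    -- At `z = 0` the factor of `i₀` vanishes because its arc is taken from the second matrix; at `z
    -- = 1` all factors are `±1`.
    Finset.prod_eq_zero (f := fun i => if s i then -0 else (1 : k)) (Finset.mem_univ i₀)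
      (by simp [hs]), sub_zero, Finset.prod_eq_zero_iff] at h1
  obtain ⟨i, -, hi⟩ := h1
  split_ifs at hi
  · exact one_ne_zero (neg_eq_zero.1 hi)
  · exact one_ne_zero hi

end Pencil

/-! ### Exchange and extension of algebraically independent families -/

/-- Adding a number `z` to the ring of coefficients spoils at most one element of an algebraically
independent family. -/
theorem AlgebraicIndependent.exists_subsingleton_compl {ι K : Type*} [Field K] [CharZero K]
    {x : ι → K} (hx : AlgebraicIndependent ℚ x) (z : K) :
    ∃ k : Subalgebra ℚ K, z ∈ k ∧ ∃ Q : Set ι, Qᶜ.Subsingleton ∧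
      AlgebraicIndependent k (fun q : Q => x q) := by
  by_cases hz : IsAlgebraic ℚ z
  · refine ⟨Algebra.adjoin ℚ {z}, Algebra.self_mem_adjoin_singleton ℚ z, Set.univ, by simp, ?_⟩
    have : Algebra.IsAlgebraic ℚ (Algebra.adjoin ℚ {z}) :=
      Subalgebra.isAlgebraic_iff _ |>.1 (Algebra.isAlgebraic_adjoin_singleton_iff.2 hz)
    exact (hx.extendScalars (Algebra.adjoin ℚ {z})).comp _ Subtype.val_injective
  rcases isEmpty_or_nonempty ι with hι | hι
  -- The empty family is separate because an intersection over no indices is everything, not `∅`.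
  · refine ⟨⊤, trivial, Set.univ, by simp, ?_⟩
    refine algebraicIndependent_empty_type_iff.2 Subtype.val_injective
  have hI : (AlgebraicIndependent.matroid ℚ K).Indep (⋃ i : ι, x '' {i}ᶜ) := by
    refine Matroid.Indep.subset (AlgebraicIndependent.matroid_indep_iff.2 hx.coe_range) ?_
    exact Set.iUnion_subset fun i => Set.image_subset_range _ _
  -- In the algebraic matroid, the closures of the families with one member omitted intersect in the
  -- closure of `∅`. A transcendental `z` therefore escapes one of them, and the member omitted
  -- there is the spoiled one.
  have hcl := Matroid.closure_iInter_eq_iInter_closure_of_iUnion_indep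
    (fun i : ι => x '' {i}ᶜ) hI
  have hempty : ⋂ i : ι, x '' {i}ᶜ = ∅ := by
    refine Set.eq_empty_of_forall_notMem fun y hy => ?_
    obtain ⟨i, -, rfl⟩ := Set.mem_iInter.1 hy hι.some
    obtain ⟨j, hj, hji⟩ := Set.mem_iInter.1 hy i
    exact hj (hx.injective hji)
  rw [hempty] at hcl
  have hz' : z ∉ (AlgebraicIndependent.matroid ℚ K).closure ∅ := by
    rw [AlgebraicIndependent.matroid_closure_eq]
    intro h
    refine hz ?_
    have h' : IsAlgebraic (Algebra.adjoin ℚ (∅ : Set K)) z := h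
    rw [Algebra.adjoin_empty] at h'
    exact Subalgebra.isAlgebraic_of_isAlgebraic_bot h'
  rw [hcl, Set.mem_iInter, not_forall] at hz'
  obtain ⟨i, hi⟩ := hz'
  have htr : Transcendental (Algebra.adjoin ℚ (Set.range fun j : ({i}ᶜ : Set ι) => x j)) z := by
    rw [← Set.image_eq_range]
    rw [AlgebraicIndependent.matroid_closure_eq] at hi
    exact hi
  have hopt := (hx.comp (Subtype.val : ({i}ᶜ : Set ι) → ι)
    Subtype.val_injective).option_iff_transcendental z |>.2 htr
  have hsum : AlgebraicIndependent ℚ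
      (Sum.elim (fun j : ({i}ᶜ : Set ι) => x j) fun _ : Unit => z) := by
    convert hopt.comp (Equiv.optionEquivSumPUnit _).symm (Equiv.injective _) using 1
    ext (j | j) <;> rfl
  exact ⟨Algebra.adjoin ℚ (Set.range fun _ : Unit => z), Algebra.subset_adjoin ⟨(), rfl⟩, {i}ᶜ,
    by simp,
    (AlgebraicIndependent.sumElim_iff.1 hsum).2⟩

/-- A countable algebraically independent family of reals can be extended. -/
theorem AlgebraicIndependent.exists_sumElim {ι : Type*} [Countable ι] {x : ι → ℝ}
    (hx : AlgebraicIndependent ℚ x) (n : ℕ) :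
    ∃ b : Fin n → ℝ, AlgebraicIndependent ℚ (Sum.elim x b) := by
  induction n with
  | zero =>
    refine ⟨Fin.elim0, ?_⟩
    convert hx.comp (Equiv.sumEmpty ι (Fin 0)) (Equiv.injective _) using 1
    ext (i | i)
    · rfl
    · exact i.elim0
  | succ n ih =>
    obtain ⟨b, hb⟩ := ih
    -- Only countably many reals are algebraic over a countable ring, so a new transcendental
    -- exists.
    have : Countable (Algebra.adjoin ℚ (Set.range (Sum.elim x b))) := by
      rw [Algebra.adjoin_range_eq_range_aeval]
      have : Countable (MvPolynomial (ι ⊕ Fin n) ℚ) := by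
        rw [← Cardinal.mk_le_aleph0_iff]
        exact MvPolynomial.cardinalMk_le_max_lift.trans (by simp [Cardinal.mk_le_aleph0])
      exact (MvPolynomial.aeval (Sum.elim x b)).rangeRestrict_surjective.countable
    have hcount := Algebraic.countable (Algebra.adjoin ℚ (Set.range (Sum.elim x b))) ℝ
    obtain ⟨t, ht⟩ : ∃ t : ℝ, Transcendental (Algebra.adjoin ℚ (Set.range (Sum.elim x b))) t := by
      by_contra! h
      refine Cardinal.not_countable_real (hcount.mono fun t _ => ?_)
      exact not_not.1 (h t)
    have hopt := (hb.option_iff_transcendental t).2 ht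
    refine ⟨Fin.cons t b, ?_⟩
    convert hopt.comp (Sum.elim (fun i => some (Sum.inl i))
      (Fin.cons none fun j => some (Sum.inr j))) ?_ using 1
    · ext (i | i)
      · rfl
      · refine Fin.cases ?_ (fun j => ?_) i <;> simp
    · refine Function.Injective.sumElim ?_ (Fin.cons_injective_iff.2 ⟨?_, ?_⟩) fun i j => ?_
      · exact (Option.some_injective _).comp Sum.inl_injective
      · simp
      · exact (Option.some_injective _).comp Sum.inr_injective
      · refine Fin.cases ?_ (fun l => ?_) j <;> simp

/-! ### Transversals -/

/-- Hall's theorem: the diagonal supplies `T` itself as neighbours of `T`. Only sets containing `x`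
lose one by the ban on `x`, and the neighbour `y` outside `T` replaces it. -/
theorem exists_injective_avoiding {ι : Type*} [Finite ι] {r : ι → ι → Prop} {W : Set ι}
    (hW : ∀ i ∈ W, r i i) (x : ι)
    (h : ∀ T ⊆ W, x ∈ T → ∃ i ∈ T, ∃ y ∉ T, r i y) :
    ∃ c : W → ι, c.Injective ∧ ∀ i : W, r i (c i) ∧ c i ≠ x := by
  classical
  have := Fintype.ofFinite ι
  refine (Fintype.all_card_le_filter_rel_iff_exists_injective
    fun (i : W) j => r i j ∧ j ≠ x).1 fun B => ?_
  rw [← Finset.card_image_of_injective B Subtype.val_injective]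
  by_cases hx : x ∈ B.image Subtype.val
  · obtain ⟨i, hi, y, hy, hiy⟩ := h (B.image Subtype.val) (by simp) (by simpa using hx)
    rw [← Finset.card_erase_add_one hx, ← Finset.card_insert_of_notMem (a := y)
      fun h => hy (Finset.mem_of_mem_erase h)]
    refine Finset.card_le_card fun j hj => ?_
    rw [Finset.mem_filter]
    refine ⟨Finset.mem_univ _, ?_⟩
    rcases Finset.mem_insert.1 hj with rfl | hj
    · obtain ⟨a, ha, rfl⟩ := Finset.mem_image.1 (Finset.mem_coe.1 hi)
      exact ⟨a, ha, hiy, fun h => hy (h ▸ hx)⟩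
    · obtain ⟨hjx, hj⟩ := Finset.mem_erase.1 hj
      obtain ⟨a, ha, rfl⟩ := Finset.mem_image.1 hj
      exact ⟨a, ha, hW a a.2, hjx⟩
  · refine Finset.card_le_card fun j hj => ?_
    obtain ⟨a, ha, rfl⟩ := Finset.mem_image.1 hj
    exact Finset.mem_filter.2 ⟨Finset.mem_univ _, a, ha, hW a a.2, fun h => hx (h ▸ hj)⟩

theorem Relation.ReflTransGen.exists_entering {α : Type*} {s : α → α → Prop} {a b : α}
    (h : Relation.ReflTransGen s a b) {T : Set α} (ha : a ∉ T) (hb : b ∈ T) :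
    ∃ i ∈ T, ∃ y ∉ T, s y i ∧ Relation.ReflTransGen s a y := by
  induction h with
  | refl => exact absurd hb ha
  | @tail c d hac hcd ih =>
    by_cases hc : c ∈ T
    · exact ih hc
    · exact ⟨d, hb, c, hc, hcd, hac⟩

theorem Relation.ReflTransGen.perm_apply_self {α : Type*} [Finite α] {s : α → α → Prop}
    (σ : Equiv.Perm α) (h : ∀ a, Relation.ReflTransGen s a (σ a)) (a : α) :
    Relation.ReflTransGen s (σ a) a := by
  have key : ∀ (n : ℕ) (b : α), Relation.ReflTransGen s b ((σ ^ n) b) := by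
    intro n b
    induction n with
    | zero => exact .refl
    | succ n ih =>
      rw [pow_succ', Equiv.Perm.mul_apply]
      exact ih.trans (h _)
  -- Going round the cycle of `σ` the remaining `orderOf σ - 1` times leads back to `a`.
  have h1 := key (orderOf σ - 1) (σ a)
  rwa [← Equiv.Perm.mul_apply, ← pow_succ, Nat.sub_add_cancel (orderOf_pos σ), pow_orderOf_eq_one,
    Equiv.Perm.one_apply] at h1

/-! ### The Hautus criterion for generic pencils with nonzero diagonal -/

section Hautus

variable {ι : Type*}

/-- The nonzero pattern of the pencil `A - s F` given by the parameters `x`. -/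
def PencilArc {K : Type*} [Zero K] (x : ι × (ι ⊕ ι) → K) (i j : ι) : Prop :=
  x (i, Sum.inl j) ≠ 0 ∨ x (i, Sum.inr j) ≠ 0

/-- Reachability of row `i` from row `j` along the arcs from column `j` to row `i`, columns being
identified with rows. -/
def PencilReach {K : Type*} [Zero K] (x : ι × (ι ⊕ ι) → K) : ι → ι → Prop :=
  Relation.ReflTransGen fun j i => PencilArc x i j

/-- The left kernel of `A - z F` contains no nonzero vector that vanishes on `S`. -/
def KernelTrivialOff {K : Type*} [CommRing K] [Fintype ι] (x : ι × (ι ⊕ ι) → K) (z : K)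
    (S : Set ι) : Prop :=
  ∀ v : ι → K, Matrix.vecMul v (pencilMinor x z id id) = 0 → (∀ i ∈ S, v i = 0) → v = 0

theorem pencilMinor_apply_eq_zero {K κ : Type*} [CommRing K] {x : ι × (ι ⊕ ι) → K} {r c : κ → ι}
    {i j : κ} (h : ¬ PencilArc x (r i) (c j)) (z : K) : pencilMinor x z r c i j = 0 := by
  simp only [PencilArc, not_or, not_not] at h
  simp [pencilMinor, h]

/-- A column of the parameter `p`. -/
def parameterColumn (p : ι × (ι ⊕ ι)) : ι := Sum.elim id id p.2

/-- The minor sees only the columns in the range of `c`, so parameters elsewhere may be zeroed and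
need not be independent over `k`. Having `z` among the scalars makes it a constant for
specialization. -/
theorem pencilMinor_det_ne_zero_of_avoiding {K κ : Type*} [Field K] [CharZero K] [Fintype κ]
    [DecidableEq κ] {x : ι × (ι ⊕ ι) → K}
    {k : Subalgebra ℚ K} {r c : κ → ι} (hr : r.Injective) (hc : c.Injective)
    (hx : AlgebraicIndependent k
      fun q : {p : ι × (ι ⊕ ι) // x p ≠ 0 ∧ parameterColumn p ∈ Set.range c} => x q)
    {z : K} (hz : z ∈ k) (hz0 : z ≠ 0) (h : ∀ i, PencilArc x (r i) (c i)) :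
    (pencilMinor x z r c).det ≠ 0 := by
  classical
  let Q : Set (ι × (ι ⊕ ι)) := {p | x p ≠ 0 ∧ parameterColumn p ∈ Set.range c}
  let y : ι × (ι ⊕ ι) → K := fun p => if p ∈ Q then x p else 0
  have hy : AlgebraicIndependent k (fun q : Q => y q) := by
    have : (fun q : Q => y q) = fun q : Q => x q := funext fun q => if_pos q.2
    rw [this]
    exact hx
  have hy0 : ∀ p ∉ Q, y p = 0 := fun p hp => if_neg hp
  have hyx : ∀ p, parameterColumn p ∈ Set.range c → y p = x p := by
    intro p hp
    by_cases hp0 : x p = 0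
    · rw [hp0]
      exact if_neg fun h => h.1 hp0
    · exact if_pos ⟨hp0, hp⟩
  have heq : pencilMinor x z r c = pencilMinor y z r c := by
    ext i j
    simp only [pencilMinor, Matrix.of_apply]
    rw [hyx, hyx] <;> exact ⟨j, rfl⟩
  rw [heq]
  refine det_pencilMinor_ne_zero hy hy0 hr hc (⟨z, hz⟩ : k) fun i => ?_
  rcases h i with h | h
  · exact Or.inl ⟨h, i, rfl⟩
  · exact Or.inr ⟨⟨h, i, rfl⟩, fun h => hz0 (congrArg Subtype.val h)⟩

variable [Fintype ι]

/-- In the chosen columns, rows outside `r` contribute nothing to the kernel equations, which thus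
restrict to a nonsingular square system. -/
theorem vanishes_of_det_pencilMinor_ne_zero {K κ : Type*} [Field K] [Fintype κ] [DecidableEq κ]
    {x : ι × (ι ⊕ ι) → K} {z : K} {v : ι → K}
    (hv : Matrix.vecMul v (pencilMinor x z id id) = 0) {r c : κ → ι} (hr : r.Injective)
    (h : ∀ i ∉ Set.range r, ∀ j, v i = 0 ∨ ¬ PencilArc x i (c j))
    (hdet : (pencilMinor x z r c).det ≠ 0) (j : κ) : v (r j) = 0 := by
  refine congrFun (Matrix.eq_zero_of_vecMul_eq_zero hdet (v := v ∘ r) ?_) j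
  ext l
  refine Eq.trans ?_ (congrFun hv (c l))
  refine Finset.sum_of_injOn r hr.injOn (by simp) (fun i _ hi => ?_) fun _ _ => rfl
  rcases h i (by simpa using hi) l with h | h
  · simp [h]
  · exact mul_eq_zero_of_right _ (pencilMinor_apply_eq_zero (r := id) (c := id) h z)

variable {x : ι × (ι ⊕ ι) → ℂ}

theorem vanishes_of_reached (hx : AlgebraicIndependent ℚ fun p : {p // x p ≠ 0} => x p)
    (hdiag : ∀ i, PencilArc x i i) {S : Set ι} {z : ℂ} (hz : z ≠ 0) {v : ι → ℂ}
    (hv : Matrix.vecMul v (pencilMinor x z id id) = 0) (hS : ∀ i ∈ S, v i = 0)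
    {c i : ι} (hc : c ∈ S) (hci : PencilReach x c i) : v i = 0 := by
  classical
  let R : Set ι := {i | ∃ c ∈ S, PencilReach x c i}
  have hRcl : ∀ i j, PencilArc x i j → j ∈ R → i ∈ R := fun i j hij ⟨c, hc, hcj⟩ =>
    ⟨c, hc, hcj.tail hij⟩
  let Q : Set {p : ι × (ι ⊕ ι) // x p ≠ 0} := {p | parameterColumn p.1 ∈ R}
  -- At most one parameter in the columns of `R` loses its independence over a ring containing `z`;
  -- the transversal `f` must avoid its column.
  obtain ⟨k, hzk, T, hT, hind⟩ :=
    (hx.comp (Subtype.val : Q → _) Subtype.val_injective).exists_subsingleton_compl z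
  obtain ⟨f, hf, hfr⟩ : ∃ f : ↥(R \ S) → ι, f.Injective ∧ ∀ i : ↥(R \ S),
      (PencilArc x i (f i) ∧ f i ∈ R) ∧ ∀ p : Q, parameterColumn p.1.1 = f i → p ∈ T := by
    by_cases hT0 : ∃ p, p ∉ T
    · obtain ⟨p, hp⟩ := hT0
      obtain ⟨d, hd, hdp⟩ : parameterColumn p.1.1 ∈ R := p.2
      obtain ⟨f, hf, hfr⟩ := exists_injective_avoiding
        (r := fun i j => PencilArc x i j ∧ j ∈ R) (W := R \ S) (fun i hi => ⟨hdiag i, hi.1⟩)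
        (parameterColumn p.1.1) fun T hTW hpT => by
          -- A path from `S` to the bad column must enter `T` from outside, which is the extra
          -- neighbour Hall's condition needs.
          obtain ⟨i, hi, y, hy, hyi, hdy⟩ :=
            hdp.exists_entering (fun h => (hTW h).2 hd) hpT
          exact ⟨i, hi, y, hy, hyi, d, hd, hdy⟩
      refine ⟨f, hf, fun i => ⟨(hfr i).1, fun q hq => by_contra fun hqT => (hfr i).2 ?_⟩⟩
      rw [← hq, hT hqT hp]
    · push Not at hT0
      exact ⟨Subtype.val, Subtype.val_injective, fun i => ⟨⟨hdiag i, i.2.1⟩, fun p _ => hT0 p⟩⟩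
  by_cases hiS : i ∈ S
  · exact hS i hiS
  refine vanishes_of_det_pencilMinor_ne_zero hv (κ := ↥(R \ S)) (c := f)
    Subtype.val_injective ?_ ?_ ⟨i, ⟨c, hc, hci⟩, hiS⟩
  · intro i hi j
    rw [Subtype.range_coe] at hi
    by_cases hiS : i ∈ S
    · exact Or.inl (hS i hiS)
    · exact Or.inr fun h => hi ⟨hRcl _ _ h (hfr j).1.2, hiS⟩
  · refine pencilMinor_det_ne_zero_of_avoiding Subtype.val_injective hf ?_ hzk hz
      fun i => (hfr i).1.1
    have hmem : ∀ p : {p : ι × (ι ⊕ ι) // x p ≠ 0 ∧ parameterColumn p ∈ Set.range f},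
        ∃ hp : (⟨p.1, p.2.1⟩ : {p // x p ≠ 0}) ∈ Q, (⟨_, hp⟩ : Q) ∈ T := by
      rintro ⟨p, hp, j, hj⟩
      have : parameterColumn p ∈ R := hj ▸ (hfr j).1.2
      exact ⟨this, (hfr j).2 _ hj.symm⟩
    refine hind.comp (fun p => ⟨_, (hmem p).2⟩) fun p q h => ?_
    exact Subtype.ext (congrArg (fun t : T => t.1.1.1) h)

/-- In a nonzero term of the Leibniz expansion every factor lies on a cycle of the permutation, so
by hypothesis none involves the second matrix. -/
theorem det_pencilMinor_eq_of_acyclic {D : Set ι} [DecidableEq ι] [Fintype D]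
    (h : ∀ i ∈ D, ∀ j, x (i, Sum.inr j) ≠ 0 → ¬ PencilReach x i j) (z : ℂ) :
    (pencilMinor x z (Subtype.val : D → ι) Subtype.val).det
      = (pencilMinor x 0 (Subtype.val : D → ι) Subtype.val).det := by
  rw [Matrix.det_apply, Matrix.det_apply]
  refine Finset.sum_congr rfl fun σ _ => congrArg _ ?_
  by_cases hσ : ∀ i, PencilArc x (σ i) i
  · refine Finset.prod_congr rfl fun i _ => ?_
    have hreach : PencilReach x (σ i) i :=
      (Relation.ReflTransGen.perm_apply_self (s := fun a b : D => PencilArc x b a) σ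
        (fun a => .single (hσ a)) i).lift Subtype.val fun _ _ h => h
    have h0 : x ((σ i : ι), Sum.inr (i : ι)) = 0 := by
      by_contra h0
      exact h _ (σ i).2 _ h0 hreach
    simp [pencilMinor, h0]
  · push Not at hσ
    obtain ⟨i, hi⟩ := hσ
    have h0 : ∀ w, ∏ i, pencilMinor x w (Subtype.val : D → ι) Subtype.val (σ i) i = 0 :=
      fun w => Finset.prod_eq_zero (Finset.mem_univ i) (pencilMinor_apply_eq_zero hi w)
    exact (h0 z).trans (h0 0).symm

/-- If every cyclic arc of the second matrix is reached from `S`, then the only possible zero of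
the pencil with inputs at `S` is `0`. -/
theorem kernelTrivialOff_of_reached (hx : AlgebraicIndependent ℚ fun p : {p // x p ≠ 0} => x p)
    (hdiag : ∀ i, PencilArc x i i) {S : Set ι}
    (hS : ∀ i j, x (i, Sum.inr j) ≠ 0 → PencilReach x i j → ∃ c ∈ S, PencilReach x c i)
    {z : ℂ} (hz : z ≠ 0) : KernelTrivialOff x z S := by
  classical
  intro v hv hvS
  let D : Set ι := {i | ∀ c ∈ S, ¬ PencilReach x c i}
  have hD : ∀ i ∉ D, v i = 0 := by
    intro i hi
    simp only [D, Set.mem_ofPred_eq, not_forall, not_not] at hi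
    obtain ⟨c, hc, hci⟩ := hi
    exact vanishes_of_reached hx hdiag hz hv hvS hc hci
  ext i
  by_cases hi : i ∈ D
  swap
  · exact hD i hi
  have hacyc : ∀ i ∈ D, ∀ j, x (i, Sum.inr j) ≠ 0 → ¬ PencilReach x i j := by
    intro i hi j hij hr
    obtain ⟨c, hc, hci⟩ := hS i j hij hr
    exact hi c hc hci
  refine vanishes_of_det_pencilMinor_ne_zero hv (κ := D) (r := Subtype.val) (c := Subtype.val)
    Subtype.val_injective (fun i hi _ => Or.inl (hD i (by simpa using hi))) ?_ ⟨i, hi⟩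
  rw [det_pencilMinor_eq_of_acyclic hacyc]
  have hdet := det_pencilMinor_ne_zero (κ := D) (r := Subtype.val) (c := Subtype.val)
    (Q := {p | x p ≠ 0}) hx (fun p hp => not_not.1 hp) Subtype.val_injective
    Subtype.val_injective 0 fun i => Or.inl ?_
  · rwa [map_zero] at hdet
  exact (hdiag i).resolve_right fun h => hacyc i i.2 i h .refl

/-- A cyclic arc of the second matrix that is not reached from `S` produces a zero of the pencil
with inputs at `S`. -/
theorem exists_reaching_of_kernelTrivialOff
    (hx : AlgebraicIndependent ℚ fun p : {p // x p ≠ 0} => x p)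
    (hdiag : ∀ i, PencilArc x i i) {S : Set ι} (hS : ∀ z, KernelTrivialOff x z S)
    {e j : ι} (hej : x (e, Sum.inr j) ≠ 0) (hr : PencilReach x e j) :
    ∃ c ∈ S, PencilReach x c e := by
  classical
  by_contra! hcon
  let D : Set ι := {i | PencilReach x i e}
  have hDS : ∀ i ∈ S, i ∉ D := hcon
  have hDcl : ∀ i ∈ D, ∀ j, PencilArc x i j → j ∈ D := fun i hi j hij =>
    Relation.ReflTransGen.head hij hi
  have he : e ∈ D := .refl
  have hjD : j ∈ D := hDcl e he j (Or.inr hej)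
  -- Row `e` is reserved for the column `j` of its entry in the second matrix; the cycle from `e` to
  -- `j` lets the other rows of `D` avoid that column.
  obtain ⟨f, hf, hfr⟩ := exists_injective_avoiding (r := PencilArc x) (W := D \ {e})
    (fun i _ => hdiag i) j fun T hTW hjT => by
      obtain ⟨i, hi, y, hy, hyi, -⟩ := hr.exists_entering (fun h => (hTW h).2 rfl) hjT
      exact ⟨i, hi, y, hy, hyi⟩
  let c : D → ι := fun i => if h : i.1 = e then j else f ⟨i, i.2, h⟩
  have hce : c ⟨e, he⟩ = j := dif_pos rfl
  have hcne : ∀ (i : D) (h : i.1 ≠ e), c i = f ⟨i, i.2, h⟩ := fun i h => dif_neg h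
  have hcarc : ∀ i : D, PencilArc x i (c i) := by
    intro i
    by_cases h : i.1 = e
    · obtain rfl : i = ⟨e, he⟩ := Subtype.ext h
      rw [hce]
      exact Or.inr hej
    · rw [hcne i h]
      exact (hfr ⟨i, i.2, h⟩).1
  have hcD : ∀ i : D, c i ∈ D := fun i => hDcl i i.2 _ (hcarc i)
  have hcinj : c.Injective := by
    intro a b hab
    by_cases ha : a.1 = e <;> by_cases hb : b.1 = e
    · exact Subtype.ext (ha.trans hb.symm)
    · obtain rfl : a = ⟨e, he⟩ := Subtype.ext ha
      rw [hce, hcne b hb] at hab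
      exact absurd hab.symm (hfr _).2
    · obtain rfl : b = ⟨e, he⟩ := Subtype.ext hb
      rw [hce, hcne a ha] at hab
      exact absurd hab (hfr _).2
    · rw [hcne a ha, hcne b hb] at hab
      have := hf hab
      exact Subtype.ext (congrArg (fun q : ↥(D \ {e}) => q.1) this)
  have hcsurj : ∀ l ∈ D, ∃ i, c i = l := by
    intro l hl
    have : Function.Surjective fun i : D => (⟨c i, hcD i⟩ : D) :=
      Finite.surjective_of_injective fun a b h => hcinj (congrArg Subtype.val h)
    obtain ⟨i, hi⟩ := this ⟨l, hl⟩
    exact ⟨i, congrArg Subtype.val hi⟩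
  let P : Polynomial ℂ := (pencilMinor (Polynomial.C ∘ x) Polynomial.X Subtype.val c).det
  have hP : ∀ z, P.eval z = (pencilMinor x z (Subtype.val : D → ι) c).det := by
    intro z
    rw [← Polynomial.coe_evalRingHom, map_det_pencilMinor]
    congr 2
    · ext p; simp
    · simp
  -- A constant `P` would take equal values at `0` and `1`, contrary to genericity of a transversal
  -- through the second matrix.
  have hdeg : P.degree ≠ 0 := by
    intro h
    refine det_pencilMinor_one_ne_zero (Q := {p | x p ≠ 0}) hx (fun p hp => not_not.1 hp)
      Subtype.val_injective hcinj hcarc (i₀ := ⟨e, he⟩) (by rw [hce]; exact hej) ?_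
    rw [← hP, ← hP, Polynomial.eq_C_of_degree_eq_zero h, Polynomial.eval_C, Polynomial.eval_C]
  obtain ⟨z, hz⟩ := IsAlgClosed.exists_root P hdeg
  rw [Polynomial.IsRoot.def, hP, ← Matrix.exists_vecMul_eq_zero_iff] at hz
  obtain ⟨w, hw0, hw⟩ := hz
  -- Extension by zero stays in the left kernel because rows of `D` have no entries in columns
  -- outside `D`.
  let v : ι → ℂ := fun i => if h : i ∈ D then w ⟨i, h⟩ else 0
  have hvD : ∀ i : D, v i = w i := fun i => dif_pos i.2
  refine hw0 (funext fun i => ?_)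
  rw [← hvD, hS z v ?_ fun i hi => dif_neg (hDS i hi)]
  · rfl
  ext l
  by_cases hl : l ∈ D
  · obtain ⟨m, rfl⟩ := hcsurj l hl
    refine Eq.trans (Eq.symm ?_) (congrFun hw m)
    refine Finset.sum_of_injOn Subtype.val Subtype.val_injective.injOn (by simp)
      (fun i _ hi => ?_) fun i _ => ?_
    · rw [show v i = 0 from dif_neg (by simpa using hi), zero_mul]
    · rw [hvD]
      rfl
  · refine Finset.sum_eq_zero fun i _ => ?_
    by_cases hi : i ∈ D
    · exact mul_eq_zero_of_right _
        (pencilMinor_apply_eq_zero (r := id) (c := id) (fun h => hl (hDcl i hi l h)) z)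
    · rw [show v i = 0 from dif_neg hi, zero_mul]

end Hautus

/-! ### Rank and transversals -/

theorem Matrix.rank_eq_card_iff_vecMul {m l K : Type*} [Field K] [Fintype m] [Fintype l]
    (M : Matrix m l K) :
    M.rank = Fintype.card m ↔ ∀ v, Matrix.vecMul v M = 0 → v = 0 := by
  rw [M.rank_eq_finrank_span_row, eq_comm]
  have h := linearIndependent_iff_card_eq_finrank_span (R := K) (b := M.row)
  rw [Set.finrank] at h
  rw [← h, ← Matrix.vecMul_injective_iff]
  exact injective_iff_map_eq_zero M.vecMulLinear

/-- Hall's theorem: vectors indexed by `B` stay independent on the union `U` of their supports, so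
`B` has at most as many elements as `U`. -/
theorem LinearIndependent.exists_injective_apply_ne_zero {ι m K : Type*} [Field K] [Fintype m]
    {w : ι → m → K} (hw : LinearIndependent K w) :
    ∃ f : ι → m, f.Injective ∧ ∀ i, w i (f i) ≠ 0 := by
  classical
  refine (Fintype.all_card_le_filter_rel_iff_exists_injective fun i j => w i j ≠ 0).1 fun B => ?_
  let U : Finset m := {j | ∃ i ∈ B, w i j ≠ 0}
  have hB : LinearIndependent K fun i : B => w i := hw.comp _ Subtype.val_injective
  have hU : LinearIndependent K fun (i : B) (j : U) => w i j := by
    rw [Fintype.linearIndependent_iff] at hB ⊢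
    refine fun g hg => hB g ?_
    ext j
    by_cases hj : j ∈ U
    · simpa using congrFun hg ⟨j, hj⟩
    · have h0 : ∀ i ∈ B, w i j = 0 := by simpa [U] using hj
      simp only [Finset.sum_apply, Pi.smul_apply, Pi.zero_apply]
      exact Finset.sum_eq_zero fun i _ => by rw [h0 i i.2, smul_zero]
  have h := hU.fintype_card_le_finrank
  rwa [Module.finrank_fintype_fun_eq_card, Fintype.card_coe, Fintype.card_coe] at h

/-! ### Matchings -/

theorem exists_isMatching_of_injective {L R : Type*} [DecidableEq L] [DecidableEq R]
    {E : Set (L × R)} {T : Finset L} {f : T → R} (hf : f.Injective) (hE : ∀ i : T, ((i : L), f i) ∈ E) :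
    IsMatching E (T.attach.image fun i : T => ((i : L), f i)) ∧
      (T.attach.image fun i : T => ((i : L), f i)).card = T.card := by
  refine ⟨⟨?_, ?_, ?_⟩, ?_⟩
  · intro p hp
    obtain ⟨i, -, rfl⟩ := Finset.mem_image.1 (Finset.mem_coe.1 hp)
    exact hE i
  · intro p hp q hq h
    obtain ⟨i, -, rfl⟩ := Finset.mem_image.1 (Finset.mem_coe.1 hp)
    obtain ⟨j, -, rfl⟩ := Finset.mem_image.1 (Finset.mem_coe.1 hq)
    rw [Subtype.ext (show (i : L) = j from h)]
  · intro p hp q hq h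
    obtain ⟨i, -, rfl⟩ := Finset.mem_image.1 (Finset.mem_coe.1 hp)
    obtain ⟨j, -, rfl⟩ := Finset.mem_image.1 (Finset.mem_coe.1 hq)
    rw [hf h]
  · rw [Finset.card_image_of_injective _ fun i j h => Subtype.ext (congrArg Prod.fst h),
      Finset.card_attach]

theorem IsSolvableSystem.exists_perm {n : ℕ} {A F : Matrix (Fin n) (Fin n) ℝ}
    (h : IsSolvableSystem A F) :
    ∃ σ : Equiv.Perm (Fin n), ∀ i, (σ i, i) ∈ matrixEdges A ∪ matrixEdges F := by
  have h1 := (Matrix.rank_eq_card_iff_vecMul _).1 (h.trans (Fintype.card_fin n).symm)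
  have hdet : (A.map (algebraMap ℝ (RatFunc ℝ))
    - (RatFunc.X : RatFunc ℝ) • F.map (algebraMap ℝ (RatFunc ℝ))).det ≠ 0 := by
    intro h0
    obtain ⟨v, hv0, hv⟩ := Matrix.exists_vecMul_eq_zero_iff.2 h0
    exact hv0 (h1 v hv)
  rw [Matrix.det_apply] at hdet
  obtain ⟨σ, -, hσ⟩ := Finset.exists_ne_zero_of_sum_ne_zero hdet
  refine ⟨σ, fun i => ?_⟩
  by_contra hi
  simp only [matrixEdges, Set.mem_union, Set.mem_ofPred_eq, not_or, not_not] at hi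
  refine hσ ?_
  rw [Finset.prod_eq_zero (Finset.mem_univ i), smul_zero]
  simp [hi]

theorem IsMaximumMatching.exists_perm {n : ℕ} {E : Set (Fin n × Fin n)}
    {N : Finset (Fin n × Fin n)} (hN : IsMaximumMatching E N)
    (hE : ∃ σ : Equiv.Perm (Fin n), ∀ i, (σ i, i) ∈ E) :
    ∃ ν : Equiv.Perm (Fin n), ∀ i j, (i, j) ∈ N ↔ ν i = j := by
  classical
  obtain ⟨σ, hσ⟩ := hE
  have hM := exists_isMatching_of_injective (E := E) (T := Finset.univ) (f := fun i => σ.symm i.1)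
    (fun i j h => Subtype.ext (σ.symm.injective h)) fun i => by simpa using hσ (σ.symm i.1)
  have hcard := hN.2 _ hM.1
  rw [hM.2, Finset.card_univ] at hcard
  have himg : N.image Prod.fst = Finset.univ := by
    rw [← Finset.card_eq_iff_eq_univ]
    refine le_antisymm (Finset.card_le_univ _) ?_
    rwa [Finset.card_image_of_injOn hN.1.2.1]
  have hex : ∀ i, ∃ j, (i, j) ∈ N := by
    intro i
    obtain ⟨⟨a, j⟩, hp, rfl⟩ := Finset.mem_image.1 (himg ▸ Finset.mem_univ i)
    exact ⟨j, hp⟩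
  choose f hf using hex
  have hfinj : f.Injective := fun a b h =>
    congrArg Prod.fst (hN.1.2.2 (hf a) (hf b) h)
  refine ⟨Equiv.ofBijective f (Finite.injective_iff_bijective.1 hfinj), fun i j => ⟨fun h => ?_, ?_⟩⟩
  · exact congrArg Prod.snd (hN.1.2.1 (hf i) h rfl)
  · rintro rfl
    exact hf i

/-! ### DM components for a perfect matching -/

section PerfectMatching

variable {n : ℕ} {E Es : Set (Fin n × Fin n)} {N : Finset (Fin n × Fin n)}
  {ν : Equiv.Perm (Fin n)}

theorem dmConsistentNodes_eq_univ (hν : ∀ i j, (i, j) ∈ N ↔ ν i = j) :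
    dmConsistentNodes E N = Set.univ := by
  refine Set.eq_univ_of_forall fun v hv => ?_
  rcases hv with ⟨r, hr, -⟩ | ⟨l, hl, -⟩
  · exact hr (ν.symm r, r) ((hν _ _).2 (by simp)) rfl
  · exact hl (l, ν l) ((hν _ _).2 rfl) rfl

theorem consistentReach_iff (hν : ∀ i j, (i, j) ∈ N ↔ ν i = j) {v w : Fin n ⊕ Fin n} :
    ConsistentReach E N v w ↔ AuxReach E N v w := by
  simp [ConsistentReach, AuxReach, dmConsistentNodes_eq_univ hν]

theorem isConsistentComponent_iff (hν : ∀ i j, (i, j) ∈ N ↔ ν i = j) {K : Set (Fin n ⊕ Fin n)} :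
    IsConsistentComponent E N K ↔ ∃ v, K = {w | AuxReach E N v w ∧ AuxReach E N w v} := by
  simp [IsConsistentComponent, dmConsistentNodes_eq_univ hν, consistentReach_iff hν]

theorem component_eq_of_mem {v w : Fin n ⊕ Fin n}
    (h : w ∈ {w | AuxReach E N v w ∧ AuxReach E N w v}) :
    {w | AuxReach E N v w ∧ AuxReach E N w v} = {u | AuxReach E N w u ∧ AuxReach E N u w} := by
  ext u
  exact ⟨fun hu => ⟨h.2.trans hu.1, hu.2.trans h.1⟩, fun hu => ⟨h.1.trans hu.1, hu.2.trans h.2⟩⟩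

/-- The consistent s-components are the components of the left ends of the s-arcs that lie on
cycles. -/
theorem isSComponent_iff (hν : ∀ i j, (i, j) ∈ N ↔ ν i = j) (hEs : Es ⊆ E)
    {K : Set (Fin n ⊕ Fin n)} :
    IsSComponent E Es N K ↔ ∃ p ∈ Es, AuxReach E N (Sum.inl p.1) (Sum.inr p.2) ∧
      K = {w | AuxReach E N (Sum.inl p.1) w ∧ AuxReach E N w (Sum.inl p.1)} := by
  constructor
  · rintro ⟨hK, p, hp, h1, h2⟩
    obtain ⟨v, rfl⟩ := (isConsistentComponent_iff hν).1 hK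
    exact ⟨p, hp, h1.2.trans h2.1, component_eq_of_mem h1⟩
  · rintro ⟨p, hp, hr, rfl⟩
    exact ⟨(isConsistentComponent_iff hν).2 ⟨_, rfl⟩, p, hp, ⟨.refl, .refl⟩, hr,
      .single (.edge (hEs hp))⟩

theorem exists_isMaximalSComponent (hν : ∀ i j, (i, j) ∈ N ↔ ν i = j) (hEs : Es ⊆ E)
    {p : Fin n × Fin n} (hp : p ∈ Es) (hr : AuxReach E N (Sum.inl p.1) (Sum.inr p.2)) :
    ∃ K, IsMaximalSComponent E Es N K ∧ ∀ w ∈ K, AuxReach E N w (Sum.inl p.1) := by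
  classical
  let up : Fin n × Fin n → Set (Fin n ⊕ Fin n) := fun q => {w | AuxReach E N w (Sum.inl q.1)}
  -- Among cyclic s-arcs above `p`, take one with the fewest nodes reaching it: a greater
  -- s-component has no more such nodes, hence the same ones, so it coincides.
  obtain ⟨q, ⟨hq, hqr, hqp⟩, hmin⟩ := Set.exists_min_image
    {q | q ∈ Es ∧ AuxReach E N (Sum.inl q.1) (Sum.inr q.2) ∧
      AuxReach E N (Sum.inl q.1) (Sum.inl p.1)}
    (fun q => (up q).ncard) (Set.toFinite _) ⟨p, hp, hr, .refl⟩
  refine ⟨{w | AuxReach E N (Sum.inl q.1) w ∧ AuxReach E N w (Sum.inl q.1)},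
    ⟨(isSComponent_iff hν hEs).2 ⟨q, hq, hqr, rfl⟩, ?_⟩, fun w hw => hw.2.trans hqp⟩
  rintro K' hK' ⟨v, hv, w, hw, hvw⟩
  obtain ⟨q', hq', hqr', rfl⟩ := (isSComponent_iff hν hEs).1 hK'
  have hle : AuxReach E N (Sum.inl q'.1) (Sum.inl q.1) := hv.1.trans (hvw.trans hw.2)
  have hsub : up q' ⊆ up q := fun u hu => Relation.ReflTransGen.trans hu hle
  have heq := Set.eq_of_subset_of_ncard_le hsub (hmin q' ⟨hq', hqr', hle.trans hqp⟩)
  have hge : AuxReach E N (Sum.inl q.1) (Sum.inl q'.1) :=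
    heq.symm.subset (show Sum.inl q.1 ∈ up q from .refl)
  exact component_eq_of_mem ⟨hle, hge⟩

/-- Each cyclic s-arc is reached from some maximal s-component, so reaching the maximal ones reaches
them all. An s-arc runs from right to left, so a path from its left end to its right end closes a
cycle. -/
theorem reachesMaximalSComponents_iff (hν : ∀ i j, (i, j) ∈ N ↔ ν i = j) (hEs : Es ⊆ E)
    {C : Set (Fin n)} :
    ReachesMaximalSComponents E Es N C ↔
      ∀ p ∈ Es, AuxReach E N (Sum.inl p.1) (Sum.inr p.2) →
        ∃ c ∈ C, AuxReach E N (Sum.inl c) (Sum.inl p.1) := by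
  constructor
  · intro h p hp hr
    obtain ⟨K, hK, hKp⟩ := exists_isMaximalSComponent hν hEs hp hr
    obtain ⟨c, hc, Kc, hKc, hcK, v, hv, w, hw, hvw⟩ := h K hK
    obtain ⟨u, rfl⟩ := (isConsistentComponent_iff hν).1 hKc
    exact ⟨c, hc, hcK.2.trans (hv.1.trans (hvw.trans (hKp w hw)))⟩
  · intro h K hK
    obtain ⟨p, hp, hr, rfl⟩ := (isSComponent_iff hν hEs).1 hK.1
    obtain ⟨c, hc, hcp⟩ := h p hp hr
    exact ⟨c, hc, _, (isConsistentComponent_iff hν).2 ⟨Sum.inl c, rfl⟩, ⟨.refl, .refl⟩,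
      Sum.inl c, ⟨.refl, .refl⟩, Sum.inl p.1, ⟨.refl, .refl⟩, hcp⟩

/-! ### The pencil with columns permuted along a perfect matching -/

/-- The entries of `A` and `F` as complex numbers, with columns permuted by `ν`. -/
def pencilParameters (A F : Matrix (Fin n) (Fin n) ℝ) (ν : Equiv.Perm (Fin n)) :
    Fin n × (Fin n ⊕ Fin n) → ℂ :=
  fun p => (Matrix.fromCols A F p.1 (Sum.map ν ν p.2) : ℝ)

variable {A F : Matrix (Fin n) (Fin n) ℝ}

theorem algebraicIndependent_pencilParameters (h : IsGeneric (Matrix.fromCols A F))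
    (ν : Equiv.Perm (Fin n)) :
    AlgebraicIndependent ℚ
      fun p : {p // pencilParameters A F ν p ≠ 0} => pencilParameters A F ν p := by
  have hinj : Function.Injective ((Algebra.ofId ℝ ℂ).restrictScalars ℚ) :=
    Complex.ofReal_injective
  have hne : ∀ p, pencilParameters A F ν p ≠ 0 →
      Matrix.fromCols A F p.1 (Sum.map ν ν p.2) ≠ 0 := fun p hp h0 => hp (by
    rw [pencilParameters, h0, Complex.ofReal_zero])
  refine (AlgebraicIndependent.map' h hinj).comp
    (fun p : {p // pencilParameters A F ν p ≠ 0} =>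
      ⟨(p.1.1, Sum.map ν ν p.1.2), hne p.1 p.2⟩) fun p q hpq => ?_
  have h1 := congrArg Subtype.val hpq
  rw [Prod.mk.injEq] at h1
  exact Subtype.ext (Prod.ext h1.1 (Sum.map_injective.2 ⟨ν.injective, ν.injective⟩ h1.2))

theorem pencilArc_iff {i j : Fin n} : PencilArc (pencilParameters A F ν) i j ↔
    (i, ν j) ∈ matrixEdges A ∪ matrixEdges F := by
  simp [PencilArc, pencilParameters, matrixEdges]

theorem pencilReach_iff (hν : ∀ i j, (i, j) ∈ N ↔ ν i = j) {i j : Fin n} :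
    PencilReach (pencilParameters A F ν) i j ↔
      AuxReach (matrixEdges A ∪ matrixEdges F) N (Sum.inl i) (Sum.inl j) := by
  constructor
  · intro h
    induction h with
    | refl => exact .refl
    | tail _ h ih =>
      exact (ih.tail (.matched ((hν _ _).2 rfl))).tail (.edge (pencilArc_iff.1 h))
  -- Contracting each matched pair to its row turns matched arcs into trivial steps and edges into
  -- pencil arcs.
  · have key : ∀ v w, AuxReach (matrixEdges A ∪ matrixEdges F) N v w →
        PencilReach (pencilParameters A F ν) (Sum.elim id ν.symm v) (Sum.elim id ν.symm w) := by
      intro v w h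
      induction h with
      | refl => exact .refl
      | tail _ h ih =>
        cases h with
        | edge h => exact ih.tail (pencilArc_iff.2 (by simpa using h))
        | matched h =>
          obtain rfl := (hν _ _).1 h
          simpa using ih
    exact key _ _

theorem auxReach_inr_iff (hN : IsMatching (matrixEdges A ∪ matrixEdges F) N)
    (hν : ∀ i j, (i, j) ∈ N ↔ ν i = j) {i j : Fin n} :
    AuxReach (matrixEdges A ∪ matrixEdges F) N (Sum.inl i) (Sum.inr (ν j)) ↔
      PencilReach (pencilParameters A F ν) i j := by
  have hj : (j, ν j) ∈ N := (hν _ _).2 rfl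
  rw [pencilReach_iff hν]
  exact ⟨fun h => h.tail (.edge (hN.1 hj)), fun h => h.tail (.matched hj)⟩

theorem reachesMaximalSComponents_iff_pencilReach
    (hN : IsMatching (matrixEdges A ∪ matrixEdges F) N)
    (hν : ∀ i j, (i, j) ∈ N ↔ ν i = j) {C : Set (Fin n)} :
    ReachesMaximalSComponents (matrixEdges A ∪ matrixEdges F) (matrixEdges F) N C ↔
      ∀ i j, pencilParameters A F ν (i, Sum.inr j) ≠ 0 →
        PencilReach (pencilParameters A F ν) i j →
        ∃ c ∈ C, PencilReach (pencilParameters A F ν) c i := by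
  rw [reachesMaximalSComponents_iff hν Set.subset_union_right]
  constructor
  · intro h i j hij hr
    obtain ⟨c, hc, hci⟩ := h (i, ν j) (by simpa [pencilParameters, matrixEdges] using hij)
      ((auxReach_inr_iff hN hν).2 hr)
    exact ⟨c, hc, (pencilReach_iff hν).2 hci⟩
  · rintro h ⟨i, j⟩ hp hr
    obtain ⟨j, rfl⟩ := ν.surjective j
    obtain ⟨c, hc, hci⟩ := h i j (by simpa [pencilParameters, matrixEdges] using hp)
      ((auxReach_inr_iff hN hν).1 hr)
    exact ⟨c, hc, (pencilReach_iff hν).1 hci⟩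

end PerfectMatching

/-! ### The zero at the origin and maximum matchings of `G_A` -/

section Kernel

variable {n : ℕ} {A F : Matrix (Fin n) (Fin n) ℝ} {S : Set (Fin n)}

theorem vecMul_pencilMinor_eq_zero_iff (ν : Equiv.Perm (Fin n)) (z : ℂ) (v : Fin n → ℂ) :
    Matrix.vecMul v (pencilMinor (pencilParameters A F ν) z id id) = 0 ↔
      Matrix.vecMul v (A.map (algebraMap ℝ ℂ) - z • F.map (algebraMap ℝ ℂ)) = 0 := by
  have key : ∀ j, Matrix.vecMul v (pencilMinor (pencilParameters A F ν) z id id) j =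
      Matrix.vecMul v (A.map (algebraMap ℝ ℂ) - z • F.map (algebraMap ℝ ℂ)) (ν j) := fun j => rfl
  refine ⟨fun h => funext fun j => ?_, fun h => funext fun j => (key j).trans (congrFun h _)⟩
  obtain ⟨j, rfl⟩ := ν.surjective j
  exact (key j).symm.trans (congrFun h j)

/-- The Popov–Belevitch–Hautus test with inputs at the nodes of the support of `b`. -/
theorem rank_fromCols_diagonal_iff (ν : Equiv.Perm (Fin n)) (b : Fin n → ℝ) (z : ℂ) :
    (Matrix.fromCols (A.map (algebraMap ℝ ℂ) - z • F.map (algebraMap ℝ ℂ))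
      ((Matrix.diagonal b).map (algebraMap ℝ ℂ))).rank = n ↔
      KernelTrivialOff (pencilParameters A F ν) z {i | b i ≠ 0} := by
  have h := Matrix.rank_eq_card_iff_vecMul
    (Matrix.fromCols (A.map (algebraMap ℝ ℂ) - z • F.map (algebraMap ℝ ℂ))
      ((Matrix.diagonal b).map (algebraMap ℝ ℂ)))
  rw [Fintype.card_fin] at h
  rw [h]
  refine forall_congr' fun v => ?_
  rw [vecMul_pencilMinor_eq_zero_iff, Matrix.vecMul_fromCols, ← and_imp]
  refine imp_congr_left ?_
  have hdiag : Matrix.vecMul v ((Matrix.diagonal b).map (algebraMap ℝ ℂ)) = 0 ↔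
      ∀ i ∈ {i | b i ≠ 0}, v i = 0 := by
    rw [Matrix.diagonal_map (map_zero _), funext_iff]
    refine forall_congr' fun i => ?_
    rw [Matrix.vecMul_diagonal]
    simp [or_iff_not_imp_right]
  rw [← hdiag, ← Sum.elim_zero_zero, Sum.elim_eq_iff]

/-- All rows outside `S` are matched, and the minor of `A` on them and their partners is generically
nonsingular. -/
theorem kernelTrivialOff_zero_of_leftUnmatched_subset (hgen : IsGeneric (Matrix.fromCols A F))
    (ν : Equiv.Perm (Fin n)) {M : Finset (Fin n × Fin n)} (hM : IsMatching (matrixEdges A) M)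
    (hMS : leftUnmatched M ⊆ S) : KernelTrivialOff (pencilParameters A F ν) 0 S := by
  classical
  intro v hv hvS
  have hex : ∀ i : ↥Sᶜ, ∃ j, (i.1, ν j) ∈ M := by
    intro i
    by_contra! h
    refine i.2 (hMS fun e he hei => h (ν.symm e.2) ?_)
    rw [Equiv.apply_symm_apply, ← hei]
    exact he
  choose f hf using hex
  have hfinj : f.Injective := fun i j h => Subtype.ext
    (congrArg Prod.fst (hM.2.2 (hf i) (hf j) (congrArg ν h)))
  have hdet := det_pencilMinor_ne_zero (κ := ↥Sᶜ) (r := Subtype.val) (c := f)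
    (Q := {p | pencilParameters A F ν p ≠ 0}) (algebraicIndependent_pencilParameters hgen ν)
    (fun p hp => not_not.1 hp) Subtype.val_injective hfinj 0 fun i => Or.inl ?_
  · rw [map_zero] at hdet
    ext i
    by_cases hi : i ∈ S
    · exact hvS i hi
    · exact vanishes_of_det_pencilMinor_ne_zero hv (κ := ↥Sᶜ) (r := Subtype.val) (c := f)
        Subtype.val_injective (fun i hi _ => Or.inl (hvS i (by simpa using hi))) hdet ⟨i, hi⟩
  · have := hM.1 (hf i)
    simpa [pencilParameters, matrixEdges] using this

theorem linearIndependent_rows_of_isMatching (hgen : IsGeneric (Matrix.fromCols A F))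
    {M : Finset (Fin n × Fin n)} (hM : IsMatching (matrixEdges A) M) :
    LinearIndependent ℂ fun p : M => (A.map (algebraMap ℝ ℂ)).row p.1.1 := by
  classical
  have hdet := det_pencilMinor_ne_zero (κ := M) (r := fun p => p.1.1) (c := fun p => p.1.2)
    (Q := {p | pencilParameters A F 1 p ≠ 0}) (algebraicIndependent_pencilParameters hgen 1)
    (fun p hp => not_not.1 hp)
    (fun p q h => Subtype.ext (hM.2.1 p.2 q.2 h)) (fun p q h => Subtype.ext (hM.2.2 p.2 q.2 h))
    0 fun i => Or.inl ?_
  · rw [Fintype.linearIndependent_iff]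
    intro g hg
    refine congrFun (Matrix.eq_zero_of_vecMul_eq_zero hdet (funext fun q => ?_))
    have hq := congrFun hg q.1.2
    simpa [Matrix.vecMul, dotProduct, pencilMinor, pencilParameters] using hq
  · have := hM.1 i.2
    simpa [pencilParameters, matrixEdges] using this

theorem exists_isMaximumMatching_of_kernelTrivialOff_zero
    (hgen : IsGeneric (Matrix.fromCols A F)) (ν : Equiv.Perm (Fin n))
    (h : KernelTrivialOff (pencilParameters A F ν) 0 S) :
    ∃ M, IsMaximumMatching (matrixEdges A) M ∧ leftUnmatched M ⊆ S := by
  classical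
  let a : Fin n → Fin n → ℂ := (A.map (algebraMap ℝ ℂ)).row
  have hS : LinearIndepOn ℂ a Sᶜ := by
    refine Fintype.linearIndependent_iff.2 fun g hg => ?_
    let v : Fin n → ℂ := fun i => if hi : i ∈ Sᶜ then g ⟨i, hi⟩ else 0
    have hv : v = 0 := by
      refine h v ((vecMul_pencilMinor_eq_zero_iff ν 0 v).2 (funext fun j => ?_))
        fun i hi => dif_neg (by simpa using hi)
      refine Eq.trans (Eq.symm ?_) (congrFun hg j)
      rw [Finset.sum_apply]
      refine Finset.sum_of_injOn Subtype.val Subtype.val_injective.injOn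
        (fun _ _ => Finset.mem_coe.2 (Finset.mem_univ _)) (fun i _ hi => ?_) fun i _ => ?_
      · exact mul_eq_zero_of_left (dif_neg (by simpa using hi)) _
      · have : v i = g i := dif_pos i.2
        simp [this, a]
    intro i
    have := congrFun hv i
    rwa [show v i = g i from dif_pos i.2] at this
  -- The rows outside `S` extend to a basis `T` of the row space of `A`. A matching covering `T` is
  -- maximum because the rows covered by any matching are independent in that space.
  obtain ⟨T, -, hST, hspan, hT⟩ := exists_linearIndepOn_extension hS (Set.subset_univ Sᶜ)
  lift T to Finset (Fin n) using Set.toFinite T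
  obtain ⟨f, hf, hfa⟩ := LinearIndependent.exists_injective_apply_ne_zero
    (w := fun i : T => a i) hT
  obtain ⟨hM, hMcard⟩ := exists_isMatching_of_injective (E := matrixEdges A) hf fun i => by
    simpa [a, matrixEdges] using hfa i
  refine ⟨_, ⟨hM, fun M' hM' => ?_⟩, fun i hi => ?_⟩
  · rw [hMcard]
    have h1 := finrank_span_eq_card (linearIndependent_rows_of_isMatching hgen hM')
    have h2 := finrank_span_eq_card (b := fun i : T => a i) hT
    rw [Fintype.card_coe] at h1 h2
    rw [← h1, ← h2]
    refine Submodule.finrank_mono (Submodule.span_le.2 ?_)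
    rintro _ ⟨p, rfl⟩
    have := hspan (Set.mem_image_of_mem a (Set.mem_univ p.1.1))
    rwa [Set.image_eq_range] at this
  · by_contra hiS
    exact hi (i, f ⟨i, hST hiS⟩) (Finset.mem_image.2 ⟨⟨i, hST hiS⟩, Finset.mem_attach _ _, rfl⟩) rfl

/-! ### Generic inputs -/

theorem exists_generic_diagonal (hgen : IsGeneric (Matrix.fromCols A F)) (S : Set (Fin n)) :
    ∃ b : Fin n → ℝ, {i | b i ≠ 0} = S ∧
      IsGeneric (Matrix.fromCols A (Matrix.fromCols F (Matrix.diagonal b))) := by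
  classical
  obtain ⟨b₀, hb₀⟩ := AlgebraicIndependent.exists_sumElim hgen n
  let b : Fin n → ℝ := fun i => if i ∈ S then b₀ i else 0
  have hb : {i | b i ≠ 0} = S := by
    ext i
    have : b₀ i ≠ 0 := hb₀.ne_zero (Sum.inr i)
    simp [b, this]
  refine ⟨b, hb, ?_⟩
  let X := Matrix.fromCols A (Matrix.fromCols F (Matrix.diagonal b))
  let H := {p : Fin n × (Fin n ⊕ Fin n) // Matrix.fromCols A F p.1 p.2 ≠ 0}
  let f : {p : Fin n × (Fin n ⊕ (Fin n ⊕ Fin n)) // X p.1 p.2 ≠ 0} → H ⊕ Fin n := fun p =>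
    match p with
    | ⟨(i, Sum.inl j), h⟩ => Sum.inl ⟨(i, Sum.inl j), h⟩
    | ⟨(i, Sum.inr (Sum.inl j)), h⟩ => Sum.inl ⟨(i, Sum.inr j), h⟩
    | ⟨(i, Sum.inr (Sum.inr _)), _⟩ => Sum.inr i
  have hd : ∀ i j, X i (Sum.inr (Sum.inr j)) ≠ 0 → i = j := fun i j h => by
    by_contra hij
    exact h (Matrix.diagonal_apply_ne b hij)
  have hf : f.Injective := by
    rintro ⟨⟨i, j | j | j⟩, hp⟩ ⟨⟨i', j' | j' | j'⟩, hp'⟩ h <;>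
      have h' := congrArg (Sum.elim (fun q : H => (Sum.inl q.1 : _ ⊕ Fin n)) Sum.inr) h <;>
      simp only [f, Sum.elim_inl, Sum.elim_inr, Sum.inl.injEq, Sum.inr.injEq, reduceCtorEq,
        Prod.mk.injEq, and_false] at h'
    · simp [h']
    · simp [h']
    · have h1 : i = j := hd _ _ hp
      have h2 : i' = j' := hd _ _ hp'
      simp [← h1, ← h2, h']
  have hval : (fun p : {p : Fin n × (Fin n ⊕ (Fin n ⊕ Fin n)) // X p.1 p.2 ≠ 0} => X p.1.1 p.1.2) =
      Sum.elim (fun p : H => Matrix.fromCols A F p.1.1 p.1.2) b₀ ∘ f := by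
    ext ⟨⟨i, j | j | j⟩, hp⟩
    · rfl
    · rfl
    · obtain rfl : i = j := hd _ _ hp
      have hi : i ∈ S := by
        rw [← hb]
        intro h0
        exact hp ((Matrix.diagonal_apply_eq b i).trans h0)
      exact (Matrix.diagonal_apply_eq b i).trans (if_pos hi)
  have hfin := hb₀.comp f hf
  rw [← hval] at hfin
  exact hfin

end Kernel

end

theorem theorem2 {n : ℕ} (A F : Matrix (Fin n) (Fin n) ℝ)
    (hgen : IsGeneric (Matrix.fromCols A F)) (hsolv : IsSolvableSystem A F)
    (N : Finset (Fin n × Fin n))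
    (hN : IsMaximumMatching (matrixEdges A ∪ matrixEdges F) N)
    (S : Set (Fin n)) :
    IsInputConfiguration A F S ↔
      ∃ (M : Finset (Fin n × Fin n)) (C : Set (Fin n)),
        IsMaximumMatching (matrixEdges A) M ∧
        ReachesMaximalSComponents (matrixEdges A ∪ matrixEdges F) (matrixEdges F) N C ∧
        leftUnmatched M ∪ C ⊆ S := by
  obtain ⟨ν, hν⟩ := hN.exists_perm hsolv.exists_perm
  have hx := algebraicIndependent_pencilParameters hgen ν
  have hdiag : ∀ i, PencilArc (pencilParameters A F ν) i i := fun i =>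
    pencilArc_iff.2 (hN.1.1 ((hν _ _).2 rfl))
  constructor
  · rintro ⟨b, rfl, -, hrank⟩
    have hker : ∀ z, KernelTrivialOff (pencilParameters A F ν) z {i | b i ≠ 0} := fun z =>
      (rank_fromCols_diagonal_iff ν b z).1 (hrank z)
    obtain ⟨M, hM, hMS⟩ := exists_isMaximumMatching_of_kernelTrivialOff_zero hgen ν (hker 0)
    -- The whole input set serves as `C`.
    exact ⟨M, {i | b i ≠ 0}, hM, (reachesMaximalSComponents_iff_pencilReach hN.1 hν).2
      fun i j hij hr => exists_reaching_of_kernelTrivialOff hx hdiag hker hij hr,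
      Set.union_subset hMS subset_rfl⟩
  · rintro ⟨M, C, hM, hC, hMC⟩
    obtain ⟨b, rfl, hb⟩ := exists_generic_diagonal hgen S
    obtain ⟨hMS, hCS⟩ := Set.union_subset_iff.1 hMC
    refine ⟨b, rfl, hb, fun z => (rank_fromCols_diagonal_iff ν b z).2 ?_⟩
    rcases eq_or_ne z 0 with rfl | hz
    · exact kernelTrivialOff_zero_of_leftUnmatched_subset hgen ν hM.1 hMS
    · refine kernelTrivialOff_of_reached hx hdiag (fun i j hij hr => ?_) hz
      obtain ⟨c, hc, hci⟩ := (reachesMaximalSComponents_iff_pencilReach hN.1 hν).1 hC i j hij hr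
      exact ⟨c, hCS hc, hci⟩
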